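/- Let $\mathfrak c=2^{\aleph_0}$ be the cardinality of $\mathbb R$. For sets $X,Y,Z$, a function $h:X\times Y\to Z$ and a positive integer $n$, let $\kappa(h,n)$ be the least cardinal of the form $|\mathcal A_0|+|\mathcal A_1|$, where $\mathcal A_0\subseteq\mathcal P(X)$ and $\mathcal A_1\subseteq\mathcal P(Y)$ are families such that every $n$-element subset of $X$ is contained in some member of $\mathcal A_0$, every $n$-element subset of $Y$ is contained in some member of $\mathcal A_1$, and $h[A_0\times A_1]\neq Z$ for all $A_0\in\mathcal A_0$, $A_1\in\mathcal A_1$. If $X=Y$, let $\kappa^-(h,n)$ be the least cardinality of a family $\mathcal A\subseteq\mathcal P(X)$ such that every $n$-element subset of $X$ is contained in some member of $\mathcal A$ and $h[A\times A]\neq Z$ for all $A\in\mathcal A$. (For infinite $Z$, as below, such families exist.) For $h:\mathbb R^\omega\times\mathbb R^\omega\to\mathbb R$, let $(\circledast^{\rm Da}_h)$ be the statement: for every $f:\mathbb R\times\mathbb R\to\mathbb R$ there are functions $g^0_n,g^1_n:\mathbb R\to\mathbb R$ $(n<\omega)$ such that $$f(x,y)=h\big(\langle g^0_n(x):n<\omega\rangle,\langle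 g^1_n(y):n<\omega\rangle\big)\quad\text{for all }x,y\in\mathbb R.$$ **Proposition.** Let $h:\mathbb R^\omega\times\mathbb R^\omega\to\mathbb R$ be a function such that at least one of the following conditions holds: (A) $\kappa(h,1)<2^{\kappa(h,1)}=\mathfrak c$; (B) $\kappa(h,1)\le\mu<\mathfrak c$ for some regular (infinite) cardinal $\mu$; (C) $\kappa^-(h,2)\le\mu<\mathfrak c$ for some regular (infinite) cardinal $\mu$. Then $(\circledast^{\rm Da}_h)$ fails. -/

import Mathlib

open Cardinal

universe u v

/-- `𝒜` covers the `n`-element subsets of `X`: every `w ∈ [X]^n` is contained in a member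
of `𝒜`. -/
def CoversSubsets {X : Type u} (n : ℕ) (𝒜 : Set (Set X)) : Prop :=
  ∀ w : Finset X, w.card = n → ∃ A ∈ 𝒜, (w : Set X) ⊆ A

/-- `𝒜₀ ⊆ 𝒫(X)` and `𝒜₁ ⊆ 𝒫(Y)` compete in the minimum that defines `κ(h, n)`. -/
def KappaAdmissible {X Y : Type u} {Z : Type v} (h : X × Y → Z) (n : ℕ)
    (𝒜₀ : Set (Set X)) (𝒜₁ : Set (Set Y)) : Prop :=
  CoversSubsets n 𝒜₀ ∧ CoversSubsets n 𝒜₁ ∧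
    ∀ A₀ ∈ 𝒜₀, ∀ A₁ ∈ 𝒜₁, h '' (A₀ ×ˢ A₁) ≠ Set.univ

/-- `𝒜 ⊆ 𝒫(X)` competes in the minimum that defines `κ⁻(h, n)`. -/
def KappaMinusAdmissible {X : Type u} {Z : Type v} (h : X × X → Z) (n : ℕ)
    (𝒜 : Set (Set X)) : Prop :=
  CoversSubsets n 𝒜 ∧ ∀ A ∈ 𝒜, h '' (A ×ˢ A) ≠ Set.univ

/-- The cardinal characteristic `κ(h, n)`, the least value of `|𝒜₀| + |𝒜₁|`. -/
noncomputable def kappa {X Y : Type u} {Z : Type v} (h : X × Y → Z) (n : ℕ) : Cardinal.{u} :=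
  sInf {c | ∃ (𝒜₀ : Set (Set X)) (𝒜₁ : Set (Set Y)),
    KappaAdmissible h n 𝒜₀ 𝒜₁ ∧ c = #𝒜₀ + #𝒜₁}

/-- The cardinal characteristic `κ⁻(h, n)`, the least value of `|𝒜|`. -/
noncomputable def kappaMinus {X : Type u} {Z : Type v} (h : X × X → Z) (n : ℕ) : Cardinal.{u} :=
  sInf {c | ∃ 𝒜 : Set (Set X), KappaMinusAdmissible h n 𝒜 ∧ c = #𝒜}

/-- The minimum defining `κ(h, n)` is taken over a nonempty set (and hence attained). -/
theorem exists_kappa_eq {X Y : Type u} {Z : Type v} [Infinite Z] (h : X × Y → Z) (n : ℕ) :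
    ∃ (𝒜₀ : Set (Set X)) (𝒜₁ : Set (Set Y)),
      KappaAdmissible h n 𝒜₀ 𝒜₁ ∧ kappa h n = #𝒜₀ + #𝒜₁ := by
  refine csInf_mem (s := {c | ∃ (𝒜₀ : Set (Set X)) (𝒜₁ : Set (Set Y)),
    KappaAdmissible h n 𝒜₀ 𝒜₁ ∧ c = #𝒜₀ + #𝒜₁})
    ⟨_, {A | A.Finite}, {A | A.Finite}, ⟨?_, ?_, ?_⟩, rfl⟩
  · exact fun w _ => ⟨w, w.finite_toSet, subset_rfl⟩
  · exact fun w _ => ⟨w, w.finite_toSet, subset_rfl⟩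
  · intro A hA B hB he
    exact Set.infinite_univ (he ▸ (Set.Finite.prod hA hB).image h)

/-- The minimum defining `κ⁻(h, n)` is taken over a nonempty set (and hence attained). -/
theorem exists_kappaMinus_eq {X : Type u} {Z : Type v} [Infinite Z] (h : X × X → Z) (n : ℕ) :
    ∃ 𝒜 : Set (Set X), KappaMinusAdmissible h n 𝒜 ∧ kappaMinus h n = #𝒜 := by
  refine csInf_mem (s := {c | ∃ 𝒜 : Set (Set X), KappaMinusAdmissible h n 𝒜 ∧ c = #𝒜})
    ⟨_, {A | A.Finite}, ⟨?_, ?_⟩, rfl⟩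
  · exact fun w _ => ⟨w, w.finite_toSet, subset_rfl⟩
  · intro A hA he
    exact Set.infinite_univ (he ▸ (Set.Finite.prod hA hA).image h)

/-- The property `(⊛^Da_h)`: every `f : ℝ × ℝ → ℝ` has the form
`f (x, y) = h (⟨g⁰ₙ(x) : n < ω⟩, ⟨g¹ₙ(y) : n < ω⟩)`. -/
def DaProperty (h : (ℕ → ℝ) × (ℕ → ℝ) → ℝ) : Prop :=
  ∀ f : ℝ × ℝ → ℝ, ∃ g₀ g₁ : ℕ → ℝ → ℝ,
    ∀ x y : ℝ, f (x, y) = h (fun n => g₀ n x, fun n => g₁ n y)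

/-! Under (B) or (C) there are at most `μ` rectangles `A t ×ˢ B t` such that each pair of points
lies in one of them and `h` omits a value `z t` on each. If `f` is represented through `h`, pulling
these back along `g₀`, `g₁` gives rectangles that cover the diagonal of the plane, with `f` omitting
`z t` on the `t`-th. A copy of `μ⁺ × μ⁺` inside `ℝ` carries an `f` for which this is impossible
(`exists_forall_rectangle`), by a strong colouring built from Ulam-style positive sets
(`exists_strong_coloring`). Under (A) a diagonal argument suffices, since `𝔠` points `y` can code
all maps `𝒜₁ → 𝒜₀`. -/

/-- In the initial ordinal of a regular cardinal `c`, sets of size less than `c` are bounded. -/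
theorem Cardinal.IsRegular.exists_forall_lt {c : Cardinal.{u}} (hc : c.IsRegular)
    (s : Set c.ord.ToType) (hs : #s < c) : ∃ b, ∀ x ∈ s, x < b := by
  have h : ¬ IsCofinal s := fun h => by
    have h1 := Order.cof_le h
    rw [Ordinal.cof_toType, hc.cof_ord] at h1
    exact absurd hs (not_lt.2 h1)
  simpa [IsCofinal] using h

/-! ### Positive sets in a successor cardinal -/

/-- A point `δ` of a linear order has cofinality at least `c`. -/
def CofAtLeast {W : Type u} [LinearOrder W] (c : Cardinal.{u}) (δ : W) : Prop :=
  ∀ s : Set W, #s < c → (∀ x ∈ s, x < δ) → ∃ η < δ, ∀ x ∈ s, x < η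

/-- A set of points of cofinality at least `c` is positive if for every self-map it contains
arbitrarily large points closed under this map. -/
def ClosurePositive {W : Type u} [LinearOrder W] (c : Cardinal.{u}) (S : Set W) : Prop :=
  ∀ (φ : W → W) (a : W), ∃ δ ∈ S, a < δ ∧ CofAtLeast c δ ∧ ∀ γ < δ, φ γ < δ

theorem mk_Iio_ord_lt {c : Cardinal.{u}} (w : c.ord.ToType) : #(Set.Iio w) < c := by
  simpa using mk_Iio_lt w (by simp)

open Order in
theorem mk_Iio_succ_ord_le {μ : Cardinal.{u}} (w : (succ μ).ord.ToType) :
    #(Set.Iio w) ≤ μ :=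
  lt_succ_iff.1 (mk_Iio_ord_lt w)

open Order in
theorem exists_forall_lt_succ {μ : Cardinal.{u}} (hμ : ℵ₀ ≤ μ)
    (s : Set (succ μ).ord.ToType) (hs : #s ≤ μ) : ∃ b, ∀ x ∈ s, x < b :=
  (isRegular_succ hμ).exists_forall_lt s (lt_succ_iff.2 hs)

-- The supremum of a strictly increasing `μ`-sequence built with `next` is a closure point; as `μ`
-- is regular, fewer than `μ` points below it lie below a single stage.
open Order in
theorem closurePositive_univ {μ : Cardinal.{u}} (hμ : μ.IsRegular) :
    ClosurePositive μ (Set.univ : Set (succ μ).ord.ToType) := by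
  intro φ a
  have hinf := hμ.aleph0_le
  have hnext : ∀ w : (succ μ).ord.ToType, ∃ b, w < b ∧ a < b ∧ ∀ γ ≤ w, φ γ < b := by
    intro w
    obtain ⟨b, hb⟩ := exists_forall_lt_succ hinf ({w, a} ∪ φ '' (Set.Iio w ∪ {w})) (by
      refine (mk_union_le _ _).trans (add_le_of_le hinf ?_ ?_)
      · exact (((Set.toFinite _).lt_aleph0).le).trans hinf
      · refine mk_image_le.trans ((mk_union_le _ _).trans
          (add_le_of_le hinf (mk_Iio_succ_ord_le w) ?_))
        simpa using (one_le_aleph0).trans hinf)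
    refine ⟨b, hb _ (by simp), hb _ (by simp), fun γ hγ => hb _ (Or.inr ⟨γ, ?_, rfl⟩)⟩
    exact hγ.lt_or_eq.imp id id
  choose next hn1 hn2 hn3 using hnext
  have hub : ∀ (τ : μ.ord.ToType) (G : ∀ σ, σ < τ → (succ μ).ord.ToType),
      ∃ b, ∀ σ (hσ : σ < τ), next (G σ hσ) < b := by
    intro τ G
    obtain ⟨b, hb⟩ := exists_forall_lt_succ hinf
      (Set.range fun σ : Set.Iio τ => next (G σ.1 σ.2))
      (mk_range_le.trans (mk_Iio_ord_lt τ).le)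
    exact ⟨b, fun σ hσ => hb _ ⟨⟨σ, hσ⟩, rfl⟩⟩
  choose ub hub using hub
  let F : μ.ord.ToType → (succ μ).ord.ToType := WellFounded.fix wellFounded_lt ub
  have hF : ∀ σ τ, σ < τ → next (F σ) < F τ := by
    intro σ τ h
    have : F τ = ub τ fun y _ => F y := WellFounded.fix_eq _ _ _
    rw [this]
    exact hub τ (fun y _ => F y) σ h
  have hgt : ∀ τ : μ.ord.ToType, ∃ τ', τ < τ' := by
    intro τ
    obtain ⟨b, hb⟩ := hμ.exists_forall_lt {τ} (by simpa using one_lt_aleph0.trans_le hinf)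
    exact ⟨b, hb τ rfl⟩
  have hne : ∃ d, ∀ τ, F τ < d := by
    obtain ⟨b, hb⟩ := exists_forall_lt_succ hinf (Set.range F) (mk_range_le.trans (by simp))
    exact ⟨b, fun τ => hb _ ⟨τ, rfl⟩⟩
  obtain ⟨δ, hδ, hmin⟩ := WellFounded.has_min
    (wellFounded_lt (α := (succ μ).ord.ToType)) {d | ∀ τ, F τ < d} hne
  have hlt : ∀ γ < δ, ∃ τ, γ ≤ F τ := by
    intro γ hγ
    by_contra! hcon
    exact hmin γ hcon hγ
  have hstep : ∀ τ, next (F τ) < δ := fun τ => by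
    obtain ⟨τ', h⟩ := hgt τ
    exact (hF _ _ h).trans (hδ τ')
  have hnonempty : Nonempty μ.ord.ToType := by
    rw [← mk_ne_zero_iff]
    simpa using hμ.ne_zero
  refine ⟨δ, trivial, ?_, ?_, ?_⟩
  · exact (hn2 _).trans (hstep hnonempty.some)
  · intro s hs hsδ
    choose! t ht using fun x hx => hlt x (hsδ x hx)
    obtain ⟨b, hb⟩ := hμ.exists_forall_lt (t '' s) (mk_image_le.trans_lt hs)
    exact ⟨F b, hδ b, fun x hx => (ht x hx).trans_lt
      ((hn1 _).trans (hF _ _ (hb _ ⟨x, hx, rfl⟩)))⟩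
  · intro γ hγ
    obtain ⟨τ, hτ⟩ := hlt γ hγ
    exact (hn3 _ _ hτ).trans (hstep τ)

-- If every piece failed, the `μ` failing maps and bounds would be dominated by one map `ψ`, and a
-- closure point of `ψ` lies in some piece.
open Order in
theorem exists_closurePositive {μ : Cardinal.{u}} (hμ : μ.IsRegular)
    (S : μ.ord.ToType → Set (succ μ).ord.ToType) (a : (succ μ).ord.ToType)
    (hS : ∀ δ, a < δ → ∃ m, δ ∈ S m) : ∃ m, ClosurePositive μ (S m) := by
  by_contra hcon
  simp only [ClosurePositive, not_exists, not_forall] at hcon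
  choose φ b hφ using hcon
  have hsup : ∀ γ, ∃ d, ∀ m, φ m γ < d ∧ b m < d := by
    intro γ
    obtain ⟨d, hd⟩ := exists_forall_lt_succ hμ.aleph0_le
      (Set.range (fun m => φ m γ) ∪ Set.range b)
      ((mk_union_le _ _).trans (add_le_of_le hμ.aleph0_le (mk_range_le.trans (by simp))
        (mk_range_le.trans (by simp))))
    exact ⟨d, fun m => ⟨hd _ (by simp), hd _ (by simp)⟩⟩
  choose ψ hψ using hsup
  obtain ⟨δ, -, hδa, hδc, hδψ⟩ := closurePositive_univ hμ ψ a
  obtain ⟨m, hm⟩ := hS δ hδa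
  exact hφ m δ ⟨hm, (hψ a m).2.trans (hδψ a hδa), hδc,
    fun γ hγ => (hψ γ m).1.trans (hδψ γ hγ)⟩

open Order in
theorem exists_injOn_Iio {μ : Cardinal.{u}} (w : (succ μ).ord.ToType) [Nonempty μ.ord.ToType] :
    ∃ e : (succ μ).ord.ToType → μ.ord.ToType, Set.InjOn e (Set.Iio w) := by
  have h : #(Set.Iio w) ≤ #μ.ord.ToType := by simpa using mk_Iio_succ_ord_le w
  obtain ⟨f⟩ := h
  classical
  refine ⟨fun x => if hx : x < w then f ⟨x, hx⟩ else Classical.arbitrary _, ?_⟩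
  intro x hx y hy hxy
  have hx' : x < w := hx
  have hy' : y < w := hy
  simp only [dif_pos hx', dif_pos hy'] at hxy
  exact congrArg Subtype.val (f.injective hxy)

open Order in
/-- A successor cardinal `μ⁺` splits into `μ` positive sets (Ulam). -/
theorem exists_forall_closurePositive_fiber {μ : Cardinal.{u}} (hμ : μ.IsRegular) :
    ∃ h : (succ μ).ord.ToType → μ.ord.ToType, ∀ i, ClosurePositive μ {δ | h δ = i} := by
  have hne : Nonempty μ.ord.ToType := by
    rw [← mk_ne_zero_iff]
    simpa using hμ.ne_zero
  choose e he using fun w : (succ μ).ord.ToType => exists_injOn_Iio w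
  have h1 : ∀ a : (succ μ).ord.ToType, ∃ m, ClosurePositive μ {δ | a < δ ∧ e δ a = m} := fun a =>
    exists_closurePositive hμ (fun m => {δ | a < δ ∧ e δ a = m}) a fun δ h => ⟨_, h, rfl⟩
  choose ν hν using h1
  -- One value `m` serves `μ⁺` many `a`. For different such `a` the sets `{δ | a < δ ∧ e δ a = m}`
  -- are disjoint, because `e δ` is injective below `δ`.
  obtain ⟨m, hm⟩ := infinite_pigeonhole_card ν (succ μ) (by simp)
    (hμ.aleph0_le.trans (le_succ μ)) (by
      rw [(isRegular_succ hμ.aleph0_le).cof_ord]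
      simp)
  have h2 : #μ.ord.ToType ≤ #(ν ⁻¹' {m}) := by simpa using (le_succ μ).trans hm
  obtain ⟨j⟩ := h2
  classical
  refine ⟨fun δ => if hδ : ∃ i, (j i).1 < δ ∧ e δ (j i).1 = m then hδ.choose else hne.some, ?_⟩
  intro i φ a
  have hj : ν (j i).1 = m := (j i).2
  obtain ⟨δ, ⟨hδ1, hδ2⟩, hδ⟩ := hν (j i).1 φ a
  refine ⟨δ, ?_, hδ⟩
  have hex : ∃ i, (j i).1 < δ ∧ e δ (j i).1 = m := ⟨i, hδ1, hδ2.trans hj⟩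
  simp only [Set.mem_ofPred_eq, dif_pos hex]
  have hs := hex.choose_spec
  exact j.injective (Subtype.ext (he δ hs.1 hδ1 (hs.2.trans (hδ2.trans hj).symm)))

/-! ### The strong colouring and its transfer to the plane -/

open Order in
/-- For regular `μ` there is a colouring of pairs from `μ⁺ × μ⁺` with `μ` colours such that every
partition of `μ⁺ × μ⁺` into `μ` pieces has a piece whose pairs receive all colours. -/
theorem exists_strong_coloring {μ : Cardinal.{u}} (hμ : μ.IsRegular) :
    ∃ g : (succ μ).ord.ToType × (succ μ).ord.ToType →
        (succ μ).ord.ToType × (succ μ).ord.ToType → μ.ord.ToType,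
      ∀ c : (succ μ).ord.ToType × (succ μ).ord.ToType → μ.ord.ToType,
        ∃ i, ∀ j, ∃ x y, c x = i ∧ c y = i ∧ g x y = j := by
  have hinf := hμ.aleph0_le
  have hreg := isRegular_succ hinf
  have hne : Nonempty μ.ord.ToType := by
    rw [← mk_ne_zero_iff]
    simpa using hμ.ne_zero
  obtain ⟨h, hh⟩ := exists_forall_closurePositive_fiber hμ
  choose e he using fun w : (succ μ).ord.ToType => exists_injOn_Iio w
  classical
  -- Fewer than `μ` points `γ < β` satisfy `e β γ ≤ e β ξ`, so a suitable `α` just below a target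
  -- `δ` of large cofinality makes `δ` the least candidate.
  let p : (succ μ).ord.ToType → (succ μ).ord.ToType → (succ μ).ord.ToType →
      (succ μ).ord.ToType → Prop := fun ξ α β γ => α ≤ γ ∧ γ < β ∧ e β γ ≤ e β ξ
  refine ⟨fun x y => if hx : ∃ γ, p x.1 x.2 y.1 γ then
    h (WellFounded.min wellFounded_lt {γ | p x.1 x.2 y.1 γ} hx) else hne.some, fun c => ?_⟩
  have hpig : ∀ f : (succ μ).ord.ToType → μ.ord.ToType, ∃ i, ∀ b, ∃ u, f u = i ∧ b < u := by
    intro f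
    obtain ⟨i, hi⟩ := infinite_pigeonhole_card f (succ μ) (by simp)
      (hinf.trans (le_succ μ)) (by rw [hreg.cof_ord]; simp)
    refine ⟨i, fun b => ?_⟩
    by_contra! hcon
    have hsub : f ⁻¹' {i} ⊆ Set.Iio b ∪ {b} := fun u hu => (hcon u hu).lt_or_eq.imp id id
    have : #(f ⁻¹' {i}) ≤ μ := (mk_le_mk_of_subset hsub).trans ((mk_union_le _ _).trans
      (add_le_of_le hinf (mk_Iio_succ_ord_le b) (by simpa using one_le_aleph0.trans hinf)))
    exact absurd (hi.trans this) (not_le.2 (lt_succ μ))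
  -- Two pigeonholes: `i` is the colour of unboundedly many `α` for each of unboundedly many `ξ`.
  choose k hk using fun ξ => hpig fun α => c (ξ, α)
  obtain ⟨i, hi⟩ := hpig k
  refine ⟨i, fun j => ?_⟩
  choose nU hU1 hU2 using hi
  choose nA hA1 hA2 using hk
  have hφ : ∀ γ, ∃ d, nU γ < d ∧ ∀ ξ ≤ γ, nA ξ γ < d := by
    intro γ
    obtain ⟨d, hd⟩ := exists_forall_lt_succ hinf
      ({nU γ} ∪ (fun ξ => nA ξ γ) '' (Set.Iio γ ∪ {γ})) (by
        refine (mk_union_le _ _).trans (add_le_of_le hinf ?_ ?_)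
        · simpa using one_le_aleph0.trans hinf
        · exact mk_image_le.trans ((mk_union_le _ _).trans (add_le_of_le hinf
            (mk_Iio_succ_ord_le γ) (by simpa using one_le_aleph0.trans hinf))))
    exact ⟨d, hd _ (by simp), fun ξ hξ => hd _ (Or.inr ⟨ξ, hξ.lt_or_eq.imp id id, rfl⟩)⟩
  choose φ hφ1 hφ2 using hφ
  obtain ⟨a⟩ : Nonempty (succ μ).ord.ToType := by
    rw [← mk_ne_zero_iff]
    simp
  obtain ⟨δ, hδj, haδ, hcof, hcl⟩ := hh j φ a
  set β := nU δ with hβ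
  have hδβ : δ < β := hU2 δ
  -- a point of the first unbounded set whose index exceeds that of `δ`
  obtain ⟨ξ, hξk, hξδ, hξe⟩ : ∃ ξ, k ξ = i ∧ ξ < δ ∧ e β δ ≤ e β ξ := by
    -- Otherwise `e β` injects a set unbounded in `δ` into the fewer than `μ` points below `e β δ`.
    by_contra! hcon
    have hsmall : #{ξ | k ξ = i ∧ ξ < δ} < μ := by
      have hinj : Set.InjOn (e β) {ξ | k ξ = i ∧ ξ < δ} :=
        (he β).mono fun x hx => hx.2.trans hδβ
      rw [← mk_image_eq_of_injOn _ _ hinj]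
      refine (mk_le_mk_of_subset ?_).trans_lt (mk_Iio_ord_lt (e β δ))
      rintro _ ⟨x, hx, rfl⟩
      exact hcon x hx.1 hx.2
    obtain ⟨η, hη, hηs⟩ := hcof _ hsmall fun x hx => hx.2
    exact (hηs (nU η) ⟨hU1 η, (hφ1 η).trans (hcl η hη)⟩).not_gt (hU2 η)
  have hFsmall : #{γ | γ < δ ∧ e β γ ≤ e β ξ} < μ := by
    have hinj : Set.InjOn (e β) {γ | γ < δ ∧ e β γ ≤ e β ξ} :=
      (he β).mono fun x hx => hx.1.trans hδβ
    rw [← mk_image_eq_of_injOn _ _ hinj]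
    have hsub : e β '' {γ | γ < δ ∧ e β γ ≤ e β ξ} ⊆ Set.Iio (e β ξ) ∪ {e β ξ} := by
      rintro _ ⟨x, hx, rfl⟩
      exact hx.2.lt_or_eq.imp id id
    exact (mk_le_mk_of_subset hsub).trans_lt ((mk_union_le _ _).trans_lt
      (add_lt_of_lt hinf (mk_Iio_ord_lt _)
        (by simpa using one_lt_aleph0.trans_le hinf)))
  obtain ⟨η, hη, hηF⟩ := hcof _ hFsmall fun x hx => hx.1
  have hmax : max ξ η < δ := max_lt hξδ hη
  set α := nA ξ (max ξ η) with hα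
  have hαδ : α < δ := (hφ2 _ ξ (le_max_left _ _)).trans (hcl _ hmax)
  have hηα : η < α := (le_max_right ξ η).trans_lt (hA2 ξ (max ξ η))
  -- The colour ignores the last coordinate, which only has to secure `c y = i`.
  refine ⟨(ξ, α), (β, nA β β), ?_, ?_, ?_⟩
  · exact (hA1 ξ _).trans hξk
  · exact (hA1 β _).trans (hU1 δ)
  · have hpδ : p ξ α β δ := ⟨hαδ.le, hδβ, hξe⟩
    have hex : ∃ γ, p ξ α β γ := ⟨δ, hpδ⟩
    simp only [dif_pos hex]
    have hmem := WellFounded.min_mem (wellFounded_lt (α := (succ μ).ord.ToType))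
      {γ | p ξ α β γ} hex
    set γ := WellFounded.min (wellFounded_lt (α := (succ μ).ord.ToType)) {γ | p ξ α β γ} hex
    have hle : γ ≤ δ := not_lt.1 (WellFounded.not_lt_min _ {γ | p ξ α β γ} hpδ)
    have : γ = δ := by
      refine hle.lt_or_eq.resolve_left fun hlt => ?_
      exact (hηF γ ⟨hlt, hmem.2.2⟩).not_ge (hηα.le.trans hmem.1)
    rw [this]
    exact hδj

open Order in
/-- For a family of at most `μ` forbidden values, there is a function `f` on the plane such that
every cover of the diagonal by `μ` rectangles contains one on which the value forbidden for it is
attained. -/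
theorem exists_forall_rectangle {μ : Cardinal.{0}} (hμ : μ.IsRegular) (hμc : μ < 𝔠)
    {T : Type} (hT : #T ≤ μ) (z : T → ℝ) :
    ∃ f : ℝ × ℝ → ℝ, ∀ P Q : T → Set ℝ, (∀ x, ∃ t, x ∈ P t ∧ x ∈ Q t) →
      ∃ t, ∃ x ∈ P t, ∃ y ∈ Q t, f (x, y) = z t := by
  obtain ⟨g, hg⟩ := exists_strong_coloring hμ
  have hX : #((succ μ).ord.ToType × (succ μ).ord.ToType) ≤ #ℝ := by
    rw [mk_real]
    simp only [mk_prod, mk_ord_toType, lift_id]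
    rw [mul_eq_self (hμ.aleph0_le.trans (le_succ μ))]
    exact succ_le_of_lt hμc
  have hT' : #T ≤ #μ.ord.ToType := by simpa using hT
  obtain ⟨ι⟩ := hX
  obtain ⟨k⟩ := hT'
  rcases isEmpty_or_nonempty T with hempty | hne
  · exact ⟨fun _ => 0, fun P Q h => (hempty.false (h 0).choose).elim⟩
  have hneX : Nonempty ((succ μ).ord.ToType × (succ μ).ord.ToType) := by
    obtain ⟨i, hi⟩ := hg fun _ => k hne.some
    obtain ⟨x, -⟩ := hi i
    exact ⟨x⟩
  refine ⟨fun q => z (Function.invFun k (g (Function.invFun ι q.1) (Function.invFun ι q.2))),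
    fun P Q h => ?_⟩
  choose t htP htQ using h
  obtain ⟨i, hi⟩ := hg fun x => k (t (ι x))
  obtain ⟨x₀, _, hx₀, -, -⟩ := hi i
  obtain ⟨x, y, hx, hy, hxy⟩ := hi i
  have hx' : t (ι x) = t (ι x₀) := k.injective (hx.trans hx₀.symm)
  have hy' : t (ι y) = t (ι x₀) := k.injective (hy.trans hx₀.symm)
  refine ⟨t (ι x₀), ι x, hx' ▸ htP _, ι y, hy' ▸ htQ _, ?_⟩
  simp only [Function.leftInverse_invFun ι.injective _, hxy, ← hx₀,
    Function.leftInverse_invFun k.injective _]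

/-! ### From covers to the failure of representability -/

theorem CoversSubsets.exists_mem {X : Type u} {𝒜 : Set (Set X)} (h : CoversSubsets 1 𝒜) (x : X) :
    ∃ A ∈ 𝒜, x ∈ A := by
  obtain ⟨A, hA, hx⟩ := h {x} (by simp)
  exact ⟨A, hA, by simpa using hx⟩

theorem CoversSubsets.exists_mem_mem {X : Type u} [Nontrivial X] {𝒜 : Set (Set X)}
    (h : CoversSubsets 2 𝒜) (x y : X) : ∃ A ∈ 𝒜, x ∈ A ∧ y ∈ A := by
  classical
  rcases eq_or_ne x y with rfl | hxy
  · obtain ⟨y, hy⟩ := exists_ne x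
    obtain ⟨A, hA, hx⟩ := h {x, y} (Finset.card_pair hy.symm)
    exact ⟨A, hA, hx (by simp), hx (by simp)⟩
  · obtain ⟨A, hA, hx⟩ := h {x, y} (Finset.card_pair hxy)
    exact ⟨A, hA, hx (by simp), hx (by simp)⟩

theorem not_daProperty_of_cover {h : (ℕ → ℝ) × (ℕ → ℝ) → ℝ} {μ : Cardinal.{0}} (hμ : μ.IsRegular)
    (hμc : μ < 𝔠) {T : Type} (hT : #T ≤ μ) (A B : T → Set (ℕ → ℝ))
    (hAB : ∀ t, h '' (A t ×ˢ B t) ≠ Set.univ) (hcov : ∀ x y, ∃ t, x ∈ A t ∧ y ∈ B t) :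
    ¬ DaProperty h := by
  intro hDa
  choose z hz using fun t => (Set.ne_univ_iff_exists_notMem _).1 (hAB t)
  obtain ⟨f, hf⟩ := exists_forall_rectangle hμ hμc hT z
  obtain ⟨g₀, g₁, hg⟩ := hDa f
  obtain ⟨t, x, hx, y, hy, hxy⟩ := hf (fun t => {x | (fun n => g₀ n x) ∈ A t})
    (fun t => {y | (fun n => g₁ n y) ∈ B t}) fun x => hcov _ _
  exact hz t ⟨(fun n => g₀ n x, fun n => g₁ n y), ⟨hx, hy⟩, (hg x y).symm.trans hxy⟩

theorem not_daProperty_of_two_power_kappa {h : (ℕ → ℝ) × (ℕ → ℝ) → ℝ}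
    (hκ : (2 : Cardinal.{0}) ^ kappa h 1 = 𝔠) : ¬ DaProperty h := by
  intro hDa
  obtain ⟨𝒜₀, 𝒜₁, ⟨h₀, h₁, hne⟩, hk⟩ := exists_kappa_eq h 1
  have hinf : ℵ₀ ≤ kappa h 1 := by
    by_contra! hlt
    exact (power_lt_aleph0 (by simp) hlt).not_ge (hκ ▸ aleph0_le_continuum)
  have hc₀ : #𝒜₀ ≤ kappa h 1 := hk ▸ self_le_add_right _ _
  have hc₁ : #𝒜₁ ≤ kappa h 1 := hk ▸ self_le_add_left _ _
  have hι : #𝒜₁ ≤ #ℝ := by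
    rw [mk_real, ← hκ]
    exact hc₁.trans (cantor _).le
  have hcode : #(𝒜₁ → 𝒜₀) ≤ #ℝ := by
    rw [mk_real, ← hκ, ← power_self_eq hinf, ← power_def]
    exact (power_le_power_right hc₀).trans
      (power_le_power_left (aleph0_pos.trans_le hinf).ne' hc₁)
  obtain ⟨ι⟩ := hι
  obtain ⟨code⟩ := hcode
  choose z hz using fun (a : 𝒜₀) (b : 𝒜₁) =>
    (Set.ne_univ_iff_exists_notMem _).1 (hne a a.2 b b.2)
  obtain ⟨A, hA, -⟩ := h₀.exists_mem 0
  obtain ⟨B, hB, -⟩ := h₁.exists_mem 0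
  have : Nonempty 𝒜₀ := ⟨⟨A, hA⟩⟩
  have : Nonempty 𝒜₁ := ⟨⟨B, hB⟩⟩
  obtain ⟨g₀, g₁, hg⟩ := hDa fun q =>
    z (Function.invFun code q.2 (Function.invFun ι q.1)) (Function.invFun ι q.1)
  choose c hc hcmem using fun b : 𝒜₁ => h₀.exists_mem fun n => g₀ n (ι b)
  -- Whichever `b` contains the sequence of `y`, the coded set `c b` contains that of `ι b`, so the
  -- value omitted on `c b × b` is attained there.
  set y := code fun b => ⟨c b, hc b⟩ with hy
  obtain ⟨b, hb, hby⟩ := h₁.exists_mem fun n => g₁ n y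
  refine hz ⟨c ⟨b, hb⟩, hc _⟩ ⟨b, hb⟩
    ⟨(fun n => g₀ n (ι ⟨b, hb⟩), fun n => g₁ n y), ⟨hcmem ⟨b, hb⟩, hby⟩, ?_⟩
  rw [← hg]
  simp only [hy, Function.leftInverse_invFun ι.injective _,
    Function.leftInverse_invFun code.injective _]

theorem mainTheorem6 (h : (ℕ → ℝ) × (ℕ → ℝ) → ℝ)
    (hyp :
      (kappa h 1 < 2 ^ kappa h 1 ∧ (2 : Cardinal.{0}) ^ kappa h 1 = 𝔠) ∨
      (∃ μ : Cardinal.{0}, μ.IsRegular ∧ kappa h 1 ≤ μ ∧ μ < 𝔠) ∨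
      (∃ μ : Cardinal.{0}, μ.IsRegular ∧ kappaMinus h 2 ≤ μ ∧ μ < 𝔠)) :
    ¬ DaProperty h := by
  rcases hyp with ⟨-, hκ⟩ | ⟨μ, hμ, hκ, hμc⟩ | ⟨μ, hμ, hκ, hμc⟩
  · exact not_daProperty_of_two_power_kappa hκ
  · obtain ⟨𝒜₀, 𝒜₁, ⟨h₀, h₁, hne⟩, hk⟩ := exists_kappa_eq h 1
    have hc₀ : #𝒜₀ ≤ μ := (hk ▸ self_le_add_right _ _ : #𝒜₀ ≤ kappa h 1).trans hκ
    have hc₁ : #𝒜₁ ≤ μ := (hk ▸ self_le_add_left _ _ : #𝒜₁ ≤ kappa h 1).trans hκ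
    refine not_daProperty_of_cover hμ hμc (T := 𝒜₀ × 𝒜₁) ?_ (fun t => t.1) (fun t => t.2)
      (fun t => hne _ t.1.2 _ t.2.2) fun x y => ?_
    · simpa using mul_le_of_le hμ.aleph0_le hc₀ hc₁
    · obtain ⟨A, hA, hx⟩ := h₀.exists_mem x
      obtain ⟨B, hB, hy⟩ := h₁.exists_mem y
      exact ⟨(⟨A, hA⟩, ⟨B, hB⟩), hx, hy⟩
  · obtain ⟨𝒜, ⟨hcov, hne⟩, hk⟩ := exists_kappaMinus_eq h 2
    refine not_daProperty_of_cover hμ hμc (T := 𝒜) (hk ▸ hκ) (fun t => t) (fun t => t)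
      (fun t => hne _ t.2) fun x y => ?_
    obtain ⟨A, hA, hx, hy⟩ := hcov.exists_mem_mem x y
    exact ⟨⟨A, hA⟩, hx, hy⟩
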